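/- A set $S\subseteq\mathbb{Z}^d$ is called sum-free if there are no $a,b,c\in S$, not necessarily distinct, with $a+b=c$. For an integer $n\ge 0$ let $[n]^d=\{1,\dots,n\}^d\subset\mathbb{Z}^d$, and let $M([n]^d)$ denote the largest size of a sum-free subset of $[n]^d$. Then for every fixed integer $d\ge 0$ (the case $d=0$ being trivial), the number of sum-free subsets of $[n]^d$ is $$2^{M([n]^d)+o(n^d)}\qquad (n\to\infty),$$ where the $o(n^d)$ term may depend on $d$; that is, there is a function $e_d:\mathbb{N}\to\mathbb{R}$ with $e_d(n)/n^d\to 0$ as $n\to\infty$ such that the number of sum-free subsets of $[n]^d$ equals $2^{M([n]^d)+e_d(n)}$ for every $n$. -/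

import Mathlib

open Filter Asymptotics

/-- A subset `S` of an additive commutative group is sum-free if there is no solution of
`a + b = c` with `a, b, c ∈ S` (the elements `a`, `b`, `c` need not be distinct). -/
def IsSumFree {G : Type*} [AddCommGroup G] (S : Set G) : Prop :=
  ∀ a ∈ S, ∀ b ∈ S, ∀ c ∈ S, a + b ≠ c

/-- The lattice box `[n]^d = {1, …, n}^d` inside `ℤ^d`. -/
noncomputable def latticeBox (n d : ℕ) : Finset (Fin d → ℤ) :=
  Fintype.piFinset fun _ => Finset.Icc (1 : ℤ) (n : ℤ)

open Classical in
/-- The family of all sum-free subsets of a finite set `R`. -/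
noncomputable def sumFreeSubsets {G : Type*} [AddCommGroup G] (R : Finset G) :
    Finset (Finset G) :=
  R.powerset.filter fun S : Finset G => IsSumFree (S : Set G)

/-- The number of sum-free subsets of `R`. -/
noncomputable def numSumFree {G : Type*} [AddCommGroup G] (R : Finset G) : ℕ :=
  (sumFreeSubsets R).card

/-- The largest size of a sum-free subset of `R` (the empty set is one, so the maximum is over a
nonempty family). -/
noncomputable def maxSumFree {G : Type*} [AddCommGroup G] (R : Finset G) : ℕ :=
  (sumFreeSubsets R).sup Finset.card

/-! The lower bound counts subsets of a largest sum-free set. The upper bound combines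
supersaturation with containers. If `A` exceeds the maximum by `ε * n ^ d`, a maximal family of
coordinatewise disjoint Schur triples is large; its translates are edge-disjoint triangles, so
triangle removal gives a positive proportion of Schur triples (`exists_schurPairs_supersaturation`).
In such an `A`, many `t` are popular, i.e. `v + t ∈ A` for many `v ∈ A`. A sum-free set with few
popular elements lies in a small set; otherwise a bounded set `T` of them and a small fingerprint
`F` confine it to a container smaller by a fixed proportion (`exists_containers`). Boundedly many
rounds bring every container down to nearly the maximum size, at a cost of `2 ^ (o(n ^ d))`
containers. -/

/-- The pairs in `A × A` whose sum lies in `A`. -/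
def schurPairs {G : Type*} [AddCommGroup G] [DecidableEq G] (A : Finset G) : Finset (G × G) :=
  (A ×ˢ A).filter fun p => p.1 + p.2 ∈ A

theorem mem_schurPairs {G : Type*} [AddCommGroup G] [DecidableEq G] {A : Finset G} {p : G × G} :
    p ∈ schurPairs A ↔ p.1 ∈ A ∧ p.2 ∈ A ∧ p.1 + p.2 ∈ A := by
  simp [schurPairs, and_assoc]

/-! ### Supersaturation via triangle removal -/

/-- Pairwise disjoint Schur triples, translated by the elements of `X`, form edge-disjoint triangles
in a tripartite graph on three copies of `V`, so that the triangle removal lemma yields many Schur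
triples. -/
theorem triangleRemovalBound_mul_le_card_schurPairs {G : Type*} [AddCommGroup G] [DecidableEq G]
    {A X V : Finset G} (hXV : X ⊆ V) (hXA : ∀ x ∈ X, ∀ a ∈ A, x + a ∈ V)
    {P : Finset (G × G)} (hP : P ⊆ schurPairs A)
    (h₁ : Set.InjOn Prod.fst (P : Set (G × G))) (h₂ : Set.InjOn Prod.snd (P : Set (G × G)))
    (h₃ : Set.InjOn (fun p => p.1 + p.2) (P : Set (G × G))) {ε : ℝ}
    (hε : ε * (3 * V.card : ℝ) ^ 2 ≤ X.card * P.card) :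
    SimpleGraph.triangleRemovalBound ε * (3 * V.card : ℝ) ^ 3 ≤ V.card * (schurPairs A).card := by
  classical
  let t : Finset (V × V × V) := Finset.univ.filter fun w =>
    w.1.1 ∈ X ∧ (w.2.1.1 - w.1.1, w.2.2.1 - w.2.1.1) ∈ P
  let T : Finset (V × V × V) := Finset.univ.filter fun w =>
    (w.2.1.1 - w.1.1, w.2.2.1 - w.2.1.1) ∈ schurPairs A
  have mem_t : ∀ {x y z : V}, (x, y, z) ∈ t ↔ x.1 ∈ X ∧ (y.1 - x.1, z.1 - y.1) ∈ P := by
    intro x y z; simp [t]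
  have hdis : SimpleGraph.TripartiteFromTriangles.ExplicitDisjoint t := by
    refine ⟨fun x y z x' h h' => ?_, fun x y z y' h h' => ?_, fun x y z z' h h' => ?_⟩
    · have := h₂ (mem_t.1 h).2 (mem_t.1 h').2 rfl
      exact Subtype.ext (by simpa using congrArg Prod.fst this)
    · have := h₃ (mem_t.1 h).2 (mem_t.1 h').2 (by simp)
      exact Subtype.ext (by simpa using congrArg Prod.fst this)
    · have := h₁ (mem_t.1 h).2 (mem_t.1 h').2 rfl
      exact Subtype.ext (by simpa using congrArg Prod.snd this)
  have hcard : X.card * P.card ≤ t.card := by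
    rw [← Finset.card_product]
    refine Finset.card_le_card_of_surjOn
      (fun w : V × V × V => (w.1.1, (w.2.1.1 - w.1.1, w.2.2.1 - w.2.1.1))) ?_
    rintro ⟨x, a, b⟩ hw
    obtain ⟨hx, hp⟩ := Finset.mem_product.1 (Finset.mem_coe.1 hw)
    obtain ⟨ha, hb, hc⟩ := mem_schurPairs.1 (hP hp)
    refine ⟨(⟨x, hXV hx⟩, ⟨x + a, hXA _ hx _ ha⟩, ⟨x + (a + b), hXA _ hx _ hc⟩), ?_, ?_⟩
    · rw [Finset.mem_coe, mem_t]
      simpa [hx] using And.intro hx hp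
    · simp
  have hfar := SimpleGraph.TripartiteFromTriangles.farFromTriangleFree (𝕜 := ℝ) t (ε := ε) (by
    rw [Fintype.card_coe]
    push_cast
    calc _ = ε * (3 * V.card : ℝ) ^ 2 := by ring
      _ ≤ _ := hε
      _ ≤ _ := by exact_mod_cast hcard)
  have hmany := hfar.le_card_cliqueFinset
  have hT : ((SimpleGraph.TripartiteFromTriangles.graph t).cliqueFinset 3).card ≤ T.card := by
    refine (Finset.card_le_card (t := T.image SimpleGraph.TripartiteFromTriangles.toTriangle)
      fun s hs => ?_).trans Finset.card_image_le
    rw [SimpleGraph.mem_cliqueFinset_iff, SimpleGraph.is3Clique_iff] at hs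
    obtain ⟨x, y, z, hxy, hxz, hyz, rfl⟩ := hs
    obtain ⟨a, b, c, habc, hab, hac, hbc⟩ :=
      SimpleGraph.TripartiteFromTriangles.graph_triple hxy hxz hyz
    rw [Finset.mem_image]
    refine ⟨(a, b, c), ?_, habc⟩
    -- The three edges may come from different members of `t`, but each one separately puts one
    -- entry of the triple in `A`.
    obtain ⟨c', hc'⟩ := SimpleGraph.TripartiteFromTriangles.Graph.in₀₁_iff.1 hab
    obtain ⟨b', hb'⟩ := SimpleGraph.TripartiteFromTriangles.Graph.in₀₂_iff.1 hac
    obtain ⟨a', ha'⟩ := SimpleGraph.TripartiteFromTriangles.Graph.in₁₂_iff.1 hbc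
    have e₁ := (mem_schurPairs.1 (hP (mem_t.1 hc').2)).1
    have e₂ := (mem_schurPairs.1 (hP (mem_t.1 hb').2)).2.2
    have e₃ := (mem_schurPairs.1 (hP (mem_t.1 ha').2)).2.1
    refine Finset.mem_filter.2 ⟨Finset.mem_univ _, mem_schurPairs.2 ⟨e₁, e₃, ?_⟩⟩
    simpa using e₂
  have hT' : T.card ≤ V.card * (schurPairs A).card := by
    rw [← Finset.card_product]
    refine Finset.card_le_card_of_injOn
      (fun w : V × V × V => (w.1.1, (w.2.1.1 - w.1.1, w.2.2.1 - w.2.1.1))) (fun w hw => ?_) ?_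
    · exact Finset.mem_product.2 ⟨w.1.2, (Finset.mem_filter.1 hw).2⟩
    · rintro ⟨x, y, z⟩ - ⟨x', y', z'⟩ - h
      simp only [Prod.mk.injEq] at h
      obtain ⟨h1, h2, h3⟩ := h
      obtain rfl := Subtype.ext h1
      obtain rfl := Subtype.ext (sub_left_injective h2)
      obtain rfl := Subtype.ext (sub_left_injective h3)
      rfl
  calc _ = SimpleGraph.triangleRemovalBound ε * (Fintype.card (V ⊕ V ⊕ V) : ℝ) ^ 3 := by
        simp only [Fintype.card_sum, Fintype.card_coe]; push_cast; ring
    _ ≤ _ := hmany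
    _ ≤ _ := by exact_mod_cast hT.trans hT'

theorem mem_sumFreeSubsets {G : Type*} [AddCommGroup G] {R S : Finset G} :
    S ∈ sumFreeSubsets R ↔ S ⊆ R ∧ IsSumFree (S : Set G) := by
  simp [sumFreeSubsets]

theorem IsSumFree.mono {G : Type*} [AddCommGroup G] {S T : Set G} (hT : IsSumFree T)
    (h : S ⊆ T) : IsSumFree S :=
  fun a ha b hb c hc => hT a (h ha) b (h hb) c (h hc)

/-- A set much larger than `maxSumFree R` contains many disjoint Schur triples. -/
theorem exists_disjoint_schurPairs {G : Type*} [AddCommGroup G] [DecidableEq G]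
    {R A : Finset G} (hA : A ⊆ R) :
    ∃ P ⊆ schurPairs A, Set.InjOn Prod.fst (P : Set (G × G)) ∧
      Set.InjOn Prod.snd (P : Set (G × G)) ∧
      Set.InjOn (fun p => p.1 + p.2) (P : Set (G × G)) ∧
      A.card ≤ maxSumFree R + 3 * P.card := by
  classical
  let F := (schurPairs A).powerset.filter fun P : Finset (G × G) => Set.InjOn Prod.fst (P : Set (G × G)) ∧
      Set.InjOn Prod.snd (P : Set (G × G)) ∧ Set.InjOn (fun p => p.1 + p.2) (P : Set (G × G))
  obtain ⟨P, hPF, hmax⟩ := F.exists_max_image Finset.card ⟨∅, by simp [F]⟩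
  obtain ⟨hP, h₁, h₂, h₃⟩ : P ⊆ schurPairs A ∧ _ := by simpa [F] using hPF
  refine ⟨P, hP, h₁, h₂, h₃, ?_⟩
  let U := P.image Prod.fst ∪ P.image Prod.snd ∪ P.image (fun p => p.1 + p.2)
  have hU : U.card ≤ 3 * P.card := by
    have := Finset.card_union_le (P.image Prod.fst ∪ P.image Prod.snd)
      (P.image (fun p => p.1 + p.2))
    have := Finset.card_union_le (P.image Prod.fst) (P.image Prod.snd)
    have := Finset.card_image_le (s := P) (f := Prod.fst)
    have := Finset.card_image_le (s := P) (f := Prod.snd)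
    have := Finset.card_image_le (s := P) (f := fun p => p.1 + p.2)
    grind
  -- A Schur triple avoiding `U` could be added to `P`, against maximality.
  have hfree : A \ U ∈ sumFreeSubsets R := by
    refine mem_sumFreeSubsets.2 ⟨Finset.sdiff_subset.trans hA, ?_⟩
    rintro a ha b hb c hc rfl
    simp only [Finset.coe_sdiff, Set.mem_sdiff, Finset.mem_coe] at ha hb hc
    have na : ∀ p ∈ P, p.1 ≠ a := fun p hp h =>
      ha.2 (by simp only [U, Finset.mem_union, Finset.mem_image]; exact .inl (.inl ⟨p, hp, h⟩))
    have nb : ∀ p ∈ P, p.2 ≠ b := fun p hp h =>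
      hb.2 (by simp only [U, Finset.mem_union, Finset.mem_image]; exact .inl (.inr ⟨p, hp, h⟩))
    have nc : ∀ p ∈ P, p.1 + p.2 ≠ a + b := fun p hp h =>
      hc.2 (by simp only [U, Finset.mem_union, Finset.mem_image]; exact .inr ⟨p, hp, h⟩)
    have hnot : (a, b) ∉ P := fun h => na _ h rfl
    have := hmax (insert (a, b) P) (by
      simp only [F, Finset.mem_filter, Finset.mem_powerset, Finset.coe_insert]
      refine ⟨Finset.insert_subset (mem_schurPairs.2 ⟨ha.1, hb.1, hc.1⟩) hP, ?_, ?_, ?_⟩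
      · refine (Set.injOn_insert (by simpa using hnot)).2 ⟨h₁, ?_⟩
        rintro ⟨p, hp, h⟩; exact na p hp h
      · refine (Set.injOn_insert (by simpa using hnot)).2 ⟨h₂, ?_⟩
        rintro ⟨p, hp, h⟩; exact nb p hp h
      · refine (Set.injOn_insert (by simpa using hnot)).2 ⟨h₃, ?_⟩
        rintro ⟨p, hp, h⟩; exact nc p hp h)
    rw [Finset.card_insert_of_notMem hnot] at this
    omega
  have hle : (A \ U).card ≤ maxSumFree R := Finset.le_sup (f := Finset.card) hfree
  have := Finset.le_card_sdiff U A
  omega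

theorem card_latticeBox (n d : ℕ) : (latticeBox n d).card = n ^ d := by
  simp [latticeBox]

theorem mem_latticeBox {n d : ℕ} {x : Fin d → ℤ} :
    x ∈ latticeBox n d ↔ ∀ i, 1 ≤ x i ∧ x i ≤ n := by
  simp [latticeBox]

/-- Supersaturation: subsets of the box noticeably larger than the largest sum-free one contain
a positive proportion of Schur triples. -/
theorem exists_schurPairs_supersaturation (d : ℕ) {ε : ℝ} (hε : 0 < ε) :
    ∃ δ > 0, ∀ n : ℕ, ∀ A ⊆ latticeBox n d,
      (maxSumFree (latticeBox n d) : ℝ) + ε * (n : ℝ) ^ d ≤ A.card →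
      δ * ((n : ℝ) ^ d) ^ 2 ≤ (schurPairs A).card := by
  -- Here `V` is `[2n]^d`, so `27 * (2 ^ d) ^ 2` is the 9 and `(2 ^ d) ^ 2` from `(3 * V.card) ^ 2`,
  -- times the 3 from `3 * P.card`.
  let η : ℝ := ε / (27 * (2 ^ d) ^ 2)
  have hη : 0 < η := by positivity
  have hpos := SimpleGraph.triangleRemovalBound_pos hη
  refine ⟨SimpleGraph.triangleRemovalBound η, hpos, fun n A hA h => ?_⟩
  obtain ⟨P, hP, h₁, h₂, h₃, hcard⟩ := exists_disjoint_schurPairs hA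
  have hcard' : (A.card : ℝ) ≤ maxSumFree (latticeBox n d) + 3 * P.card := by exact_mod_cast hcard
  have key := triangleRemovalBound_mul_le_card_schurPairs (A := A) (X := latticeBox n d)
    (V := latticeBox (2 * n) d) (ε := η) ?_ ?_ hP h₁ h₂ h₃ ?_
  · rw [card_latticeBox] at key
    push_cast at key
    rcases eq_or_lt_of_le (show (0 : ℝ) ≤ (n : ℝ) ^ d by positivity) with h0 | h0
    · rw [← h0]; simp
    · rw [mul_pow 2 (n : ℝ) d] at key
      have h2 : (1 : ℝ) ≤ 2 ^ d := one_le_pow₀ (by norm_num)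
      have h3 : (2 ^ d * (n : ℝ) ^ d) * (SimpleGraph.triangleRemovalBound η * ((n : ℝ) ^ d) ^ 2) ≤
          (2 ^ d * (n : ℝ) ^ d) * (schurPairs A).card := by
        refine le_trans ?_ key
        have : (1 : ℝ) ≤ 27 * (2 ^ d) ^ 2 := by nlinarith
        calc _ = (SimpleGraph.triangleRemovalBound η * (2 ^ d * ((n : ℝ) ^ d) ^ 3)) * 1 := by ring
          _ ≤ (SimpleGraph.triangleRemovalBound η * (2 ^ d * ((n : ℝ) ^ d) ^ 3)) *
              (27 * (2 ^ d) ^ 2) := by gcongr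
          _ = _ := by ring
      exact le_of_mul_le_mul_left h3 (by positivity)
  · intro x hx
    rw [mem_latticeBox] at hx ⊢
    intro i
    have := hx i
    push_cast
    omega
  · intro x hx a ha
    have ha := hA ha
    rw [mem_latticeBox] at hx ha ⊢
    intro i
    have := hx i
    have := ha i
    simp only [Pi.add_apply]
    push_cast
    omega
  · rw [card_latticeBox, card_latticeBox]
    push_cast
    have hPε : ε * (n : ℝ) ^ d ≤ 3 * P.card := by linarith
    have : η * (3 * (2 * (n : ℝ)) ^ d) ^ 2 = (n : ℝ) ^ d * (ε * (n : ℝ) ^ d) / 3 := by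
      simp only [η, mul_pow]
      field_simp
      ring
    rw [this]
    have hn : (0 : ℝ) ≤ (n : ℝ) ^ d := by positivity
    nlinarith [mul_le_mul_of_nonneg_left hPε hn]

/-! ### Containers from fingerprints -/

/-- The elements of `A` of the form `f + t` with `f ∈ F` and `t ∈ T`. -/
def translateShadow {G : Type*} [AddCommGroup G] [DecidableEq G] (A T F : Finset G) : Finset G :=
  A ∩ Finset.image₂ (· + ·) F T

/-- The container determined by the fingerprint `F`: the elements of `A` outside the shadow of `F`
that have fewer than `γ` translates by `T` in `A` outside this shadow. -/
noncomputable def translateContainer {G : Type*} [AddCommGroup G] [DecidableEq G]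
    (A T : Finset G) (γ : ℝ) (F : Finset G) : Finset G :=
  (A \ translateShadow A T F).filter fun v =>
    ((T.filter fun t => v + t ∈ A \ translateShadow A T F).card : ℝ) < γ

/-- The subsets of `A` with at most `s` elements. -/
noncomputable def smallSubsets {α : Type*} (A : Finset α) (s : ℝ) : Finset (Finset α) :=
  A.powerset.filter fun S => (S.card : ℝ) ≤ s

theorem mem_smallSubsets {α : Type*} {A S : Finset α} {s : ℝ} :
    S ∈ smallSubsets A s ↔ S ⊆ A ∧ (S.card : ℝ) ≤ s := by
  simp [smallSubsets]

section

variable {G : Type*} [AddCommGroup G] [DecidableEq G]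

theorem translateContainer_subset {A T F : Finset G} {γ : ℝ} : translateContainer A T γ F ⊆ A :=
  (Finset.filter_subset _ _).trans Finset.sdiff_subset

theorem mem_translateShadow {A T F : Finset G} {v : G} :
    v ∈ translateShadow A T F ↔ v ∈ A ∧ ∃ f ∈ F, ∃ t ∈ T, f + t = v := by
  simp [translateShadow, Finset.mem_image₂]

/-- Take `F` largest with shadow at least `γ * F.card`. Sum-freeness keeps `S` off the shadow, and
an element of `S` with `γ` fresh translates could be added to `F`. -/
theorem IsSumFree.exists_subset_translateContainer {A T S : Finset G} (hSA : S ⊆ A)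
    (hS : IsSumFree (S : Set G)) (hT : T ⊆ S) {γ : ℝ} (hγ : 0 < γ) :
    ∃ F ⊆ S, γ * F.card ≤ A.card ∧ S ⊆ translateContainer A T γ F := by
  obtain ⟨F, hF, hmax⟩ := (S.powerset.filter fun F =>
    γ * (F.card : ℝ) ≤ (translateShadow A T F).card).exists_max_image Finset.card
      ⟨∅, by simp⟩
  simp only [Finset.mem_filter, Finset.mem_powerset] at hF hmax
  obtain ⟨hFS, hFc⟩ := hF
  refine ⟨F, hFS, hFc.trans (by exact_mod_cast Finset.card_le_card Finset.inter_subset_left),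
    fun v hv => ?_⟩
  refine Finset.mem_filter.2 ⟨Finset.mem_sdiff.2 ⟨hSA hv, fun h => ?_⟩, ?_⟩
  · obtain ⟨-, f, hf, t, ht, h⟩ := mem_translateShadow.1 h
    exact hS f (hFS hf) t (hT ht) v hv h
  · by_contra! hge
    set T' := T.filter fun t => v + t ∈ A \ translateShadow A T F with hT'
    have hvF : v ∉ F := by
      intro hvF
      have : T' = ∅ := by
        refine Finset.filter_eq_empty_iff.2 fun t ht h => ?_
        rw [Finset.mem_sdiff] at h
        exact h.2 (mem_translateShadow.2 ⟨h.1, v, hvF, t, ht, rfl⟩)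
      rw [this] at hge
      simp only [Finset.card_empty, Nat.cast_zero] at hge
      linarith
    have hdisj : Disjoint (translateShadow A T F) (T'.image (v + ·)) := by
      rw [Finset.disjoint_right]
      intro w hw
      obtain ⟨t, ht, rfl⟩ := Finset.mem_image.1 hw
      exact (Finset.mem_sdiff.1 (Finset.mem_filter.1 ht).2).2
    have hsub : translateShadow A T F ∪ T'.image (v + ·) ⊆ translateShadow A T (insert v F) := by
      refine Finset.union_subset (fun w hw => ?_) (fun w hw => ?_)
      · obtain ⟨h, f, hf, t, ht, e⟩ := mem_translateShadow.1 hw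
        exact mem_translateShadow.2 ⟨h, f, Finset.mem_insert_of_mem hf, t, ht, e⟩
      · obtain ⟨t, ht, rfl⟩ := Finset.mem_image.1 hw
        obtain ⟨htT, h⟩ := Finset.mem_filter.1 ht
        exact mem_translateShadow.2 ⟨(Finset.mem_sdiff.1 h).1, v, Finset.mem_insert_self _ _, t,
          htT, rfl⟩
    have hc := Finset.card_le_card hsub
    rw [Finset.card_union_of_disjoint hdisj,
      Finset.card_image_of_injective _ (add_right_injective v)] at hc
    have hc' : ((translateShadow A T F).card : ℝ) + T'.card ≤
        (translateShadow A T (insert v F)).card := by exact_mod_cast hc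
    have := hmax (insert v F) ⟨Finset.insert_subset hv hFS, by
      rw [Finset.card_insert_of_notMem hvF]
      push_cast
      linarith⟩
    rw [Finset.card_insert_of_notMem hvF] at this
    omega

/-- Double counting of pairs `(v, t)` with `v + t ∈ A`: either `v` is outside the container, or `v +
t` is in the shadow (also outside it), or `v` is in the container and has fewer than `γ` such `t`.
-/
theorem card_mul_le_of_translateContainer {A T F : Finset G} {γ m : ℝ} (hγ : 0 ≤ γ)
    (hm : ∀ t ∈ T, m ≤ (A.filter fun v => v + t ∈ A).card) :
    T.card * m ≤ 2 * T.card * (A \ translateContainer A T γ F).card + γ * A.card := by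
  set X := translateShadow A T F with hX
  set C := translateContainer A T γ F with hC
  let E := (A ×ˢ T).filter fun p => p.1 + p.2 ∈ A
  have hE : (T.card : ℝ) * m ≤ E.card := by
    have hEc : E.card = ∑ t ∈ T, (A.filter fun v => v + t ∈ A).card := by
      simp only [E, Finset.card_filter, Finset.sum_product_right]
    rw [hEc]
    push_cast
    rw [← nsmul_eq_mul]
    exact Finset.card_nsmul_le_sum _ _ _ hm
  let E₂ := (A ×ˢ T).filter fun p => p.1 + p.2 ∈ X
  let E₃ := (C ×ˢ T).filter fun p => p.1 + p.2 ∈ A \ X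
  have hsub : E ⊆ ((A \ C) ×ˢ T) ∪ E₂ ∪ E₃ := by
    rintro ⟨v, t⟩ h
    simp only [E, E₂, E₃, Finset.mem_union, Finset.mem_filter, Finset.mem_product,
      Finset.mem_sdiff] at h ⊢
    tauto
  have hE₂ : E₂.card ≤ (A \ C).card * T.card := by
    have hXC : X.card ≤ (A \ C).card := by
      refine Finset.card_le_card fun v hv => Finset.mem_sdiff.2 ⟨Finset.inter_subset_left hv, ?_⟩
      intro h
      exact (Finset.mem_sdiff.1 (Finset.mem_filter.1 h).1).2 hv
    refine le_trans ?_ (Nat.mul_le_mul_right _ hXC)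
    rw [← Finset.card_product]
    refine Finset.card_le_card_of_injOn (fun p => (p.1 + p.2, p.2)) (fun p hp => ?_) ?_
    · have hp := Finset.mem_filter.1 (Finset.mem_coe.1 hp)
      exact Finset.mem_coe.2 (Finset.mem_product.2 ⟨hp.2, (Finset.mem_product.1 hp.1).2⟩)
    · rintro ⟨v, t⟩ - ⟨v', t'⟩ - h
      simp only [Prod.mk.injEq] at h
      obtain ⟨h, rfl⟩ := h
      simpa using h
  have hE₃ : (E₃.card : ℝ) ≤ γ * A.card := by
    have : E₃.card = ∑ v ∈ C, (T.filter fun t => v + t ∈ A \ X).card := by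
      simp only [E₃, Finset.card_filter, Finset.sum_product]
    rw [this]
    push_cast
    calc _ ≤ C.card • γ := Finset.sum_le_card_nsmul _ _ _ fun v hv =>
          (Finset.mem_filter.1 hv).2.le
      _ ≤ _ := by
        rw [nsmul_eq_mul, mul_comm]
        have : C.card ≤ A.card := Finset.card_le_card translateContainer_subset
        gcongr
  have hEc : (E.card : ℝ) ≤ (A \ C).card * T.card + E₂.card + E₃.card := by
    have h1 := Finset.card_le_card hsub
    have h2 := Finset.card_union_le (((A \ C) ×ˢ T) ∪ E₂) E₃
    have h3 := Finset.card_union_le ((A \ C) ×ˢ T) E₂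
    rw [Finset.card_product] at h3
    exact_mod_cast h1.trans (h2.trans (Nat.add_le_add_right h3 _))
  have hE₂' : (E₂.card : ℝ) ≤ (A \ C).card * T.card := by exact_mod_cast hE₂
  linarith

theorem card_schurPairs_eq_sum (A : Finset G) :
    (schurPairs A).card = ∑ t ∈ A, (A.filter fun v => v + t ∈ A).card := by
  simp only [schurPairs, Finset.card_filter, Finset.sum_product_right]

/-- A set with many Schur triples has few containers for its sum-free subsets, each of them
substantially smaller than the set itself. -/
theorem exists_containers {A : Finset G} {N δ s : ℝ} (hN : 0 < N) (hδ : 0 < δ)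
    (hA : (A.card : ℝ) ≤ N) (hsch : δ * N ^ 2 ≤ (schurPairs A).card) {q : ℕ} (hq : 0 < q)
    (hqs : (q : ℝ) ≤ s) (hqN : (q : ℝ) ≤ 3 / 8 * δ * N) (hs : 4 * N ≤ δ * q * s) :
    ∃ 𝒞 : Finset (Finset G), 𝒞.card ≤ (smallSubsets A s).card ^ 2 ∧
      (∀ B ∈ 𝒞, B ⊆ A ∧ (B.card : ℝ) ≤ A.card - δ / 8 * N) ∧
      ∀ S ⊆ A, IsSumFree (S : Set G) → ∃ B ∈ 𝒞, S ⊆ B := by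
  have hq' : (0 : ℝ) < q := by exact_mod_cast hq
  let D := A.filter fun t => δ * N / 2 ≤ ((A.filter fun v => v + t ∈ A).card : ℝ)
  have hDA : D ⊆ A := Finset.filter_subset _ _
  have hD : δ * N / 2 ≤ D.card := by
    have h1 : ((schurPairs A).card : ℝ) ≤ D.card * N + N * (δ * N / 2) := by
      rw [card_schurPairs_eq_sum]
      push_cast
      rw [← Finset.sum_filter_add_sum_filter_not A
        (fun t => δ * N / 2 ≤ ((A.filter fun v => v + t ∈ A).card : ℝ))]
      refine add_le_add ?_ ?_
      · rw [← nsmul_eq_mul]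
        refine Finset.sum_le_card_nsmul _ _ _ fun t _ => le_trans ?_ hA
        exact_mod_cast Finset.card_le_card (Finset.filter_subset _ _)
      · refine (Finset.sum_le_card_nsmul _ _ (δ * N / 2) fun t ht => ?_).trans ?_
        · exact (not_le.1 (Finset.mem_filter.1 ht).2).le
        · rw [nsmul_eq_mul]
          have : ((A.filter fun t =>
              ¬ δ * N / 2 ≤ ((A.filter fun v => v + t ∈ A).card : ℝ)).card : ℝ) ≤ N :=
            le_trans (by exact_mod_cast Finset.card_le_card (Finset.filter_subset _ _)) hA
          gcongr
    have h2 : N * (δ * N / 2) ≤ N * D.card := by nlinarith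
    exact le_of_mul_le_mul_left h2 hN
  -- Then `γ * N` is half of `q * (δ * N / 2)`, which leaves a loss of `δ / 8 * N`.
  let γ : ℝ := δ * q / 4
  have hγ : 0 < γ := by positivity
  let g : Finset G × Finset G → Finset G := fun p =>
    if p.1.card < q then (A \ D) ∪ p.1 else translateContainer A p.1 γ p.2
  let K := (smallSubsets A s ×ˢ smallSubsets A s).filter fun p => p.1 ⊆ D ∧ p.1.card ≤ q
  refine ⟨K.image g, ?_, ?_, ?_⟩
  · refine Finset.card_image_le.trans ((Finset.card_le_card (Finset.filter_subset _ _)).trans ?_)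
    rw [Finset.card_product, sq]
  · intro B hB
    obtain ⟨⟨T, F⟩, hp, rfl⟩ := Finset.mem_image.1 hB
    obtain ⟨-, hTD, hTq⟩ := Finset.mem_filter.1 hp
    dsimp only at hTD hTq
    by_cases hlt : T.card < q
    · simp only [g, hlt, if_true]
      refine ⟨Finset.union_subset Finset.sdiff_subset (hTD.trans hDA), ?_⟩
      -- Removing `D` loses `δ * N / 2`; restoring `T` costs at most `3 / 8 * δ * N`.
      have h1 := Finset.card_union_le (A \ D) T
      have h2 := Finset.card_sdiff_add_card_eq_card hDA
      have h1' : (((A \ D) ∪ T).card : ℝ) ≤ (A \ D).card + T.card := by exact_mod_cast h1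
      have h2' : ((A \ D).card : ℝ) + D.card = A.card := by exact_mod_cast h2
      have h3 : (T.card : ℝ) ≤ q := by exact_mod_cast hTq
      linarith
    · simp only [g, hlt, if_false]
      refine ⟨translateContainer_subset, ?_⟩
      have hTc : T.card = q := by omega
      have h1 := card_mul_le_of_translateContainer (A := A) (T := T) (F := F) (γ := γ)
        (m := δ * N / 2) hγ.le fun t ht => (Finset.mem_filter.1 (hTD ht)).2
      rw [hTc] at h1
      have h2 := Finset.card_sdiff_add_card_eq_card
        (translateContainer_subset (A := A) (T := T) (F := F) (γ := γ))
      have h2' : ((A \ translateContainer A T γ F).card : ℝ) +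
        (translateContainer A T γ F).card = A.card := by exact_mod_cast h2
      have h3 : γ * A.card ≤ γ * N := by gcongr
      have h4 : (q : ℝ) * (δ / 8 * N) ≤ q * (A \ translateContainer A T γ F).card := by
        simp only [γ] at h1 h3 ⊢
        linarith
      have := le_of_mul_le_mul_left h4 hq'
      linarith
  · intro S hSA hS
    have hs0 : 0 ≤ s := hq'.le.trans hqs
    by_cases hlt : (S ∩ D).card < q
    · refine ⟨g (S ∩ D, ∅), Finset.mem_image_of_mem _ (Finset.mem_filter.2
        ⟨Finset.mem_product.2 ⟨mem_smallSubsets.2 ⟨Finset.inter_subset_left.trans hSA, ?_⟩,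
          mem_smallSubsets.2 ⟨Finset.empty_subset _, by simpa using hs0⟩⟩,
          Finset.inter_subset_right, hlt.le⟩), ?_⟩
      · refine le_trans ?_ hqs
        exact_mod_cast hlt.le
      · simp only [g, hlt, if_true]
        intro x hx
        simp only [Finset.mem_union, Finset.mem_sdiff, Finset.mem_inter]
        have := hSA hx
        tauto
    · obtain ⟨T, hT, hTc⟩ := Finset.exists_subset_card_eq (not_lt.1 hlt)
      have hTS : T ⊆ S := hT.trans Finset.inter_subset_left
      obtain ⟨F, hFS, hFc, hSF⟩ := hS.exists_subset_translateContainer hSA hTS hγ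
      refine ⟨g (T, F), Finset.mem_image_of_mem _ (Finset.mem_filter.2
        ⟨Finset.mem_product.2 ⟨mem_smallSubsets.2 ⟨hTS.trans hSA, by rw [hTc]; exact hqs⟩,
          mem_smallSubsets.2 ⟨hFS.trans hSA, ?_⟩⟩, hT.trans Finset.inter_subset_right, hTc.le⟩),
          ?_⟩
      · refine le_of_mul_le_mul_left (a := γ) ?_ hγ
        refine hFc.trans (hA.trans ?_)
        simp only [γ]
        linarith
      · simpa only [g, hTc, lt_irrefl, if_false] using hSF

end

/-- Weight each subset by `x ^ S.card` with `x ≤ 1`, and compare with the binomial sum `(x + 1) ^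
A.card`. Both `x` and `θ` are chosen to spend half of the exponent each. -/
theorem exists_card_smallSubsets_le {κ : ℝ} (hκ : 0 < κ) :
    ∃ θ > 0, ∀ {α : Type} (A : Finset α) (N : ℝ), (A.card : ℝ) ≤ N →
      ((smallSubsets A (θ * N)).card : ℝ) ≤ 2 ^ (κ * N) := by
  have hlog2 : 0 < Real.log 2 := Real.log_pos (by norm_num)
  let x : ℝ := min 1 (κ * Real.log 2 / 2)
  have hx0 : 0 < x := lt_min one_pos (by positivity)
  have hx1 : x ≤ 1 := min_le_left _ _
  have hx2 : x ≤ κ * Real.log 2 / 2 := min_le_right _ _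
  have hlogx : Real.log x ≤ 0 := Real.log_nonpos hx0.le hx1
  let θ : ℝ := κ * Real.log 2 / (2 * (1 - Real.log x))
  have hden : 0 < 2 * (1 - Real.log x) := by linarith
  have hθ : 0 < θ := by positivity
  refine ⟨θ, hθ, fun {α} A N hA => ?_⟩
  classical
  have hN : 0 ≤ N := le_trans (Nat.cast_nonneg _) hA
  have h1 : ((smallSubsets A (θ * N)).card : ℝ) * x ^ (θ * N) ≤ (x + 1) ^ A.card := by
    calc _ = ∑ S ∈ smallSubsets A (θ * N), x ^ (θ * N) := by rw [Finset.sum_const, nsmul_eq_mul]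
      _ ≤ ∑ S ∈ smallSubsets A (θ * N), x ^ S.card * 1 ^ (A.card - S.card) := by
        refine Finset.sum_le_sum fun S hS => ?_
        rw [one_pow, mul_one, ← Real.rpow_natCast]
        exact Real.rpow_le_rpow_of_exponent_ge hx0 hx1 (mem_smallSubsets.1 hS).2
      _ ≤ ∑ S ∈ A.powerset, x ^ S.card * 1 ^ (A.card - S.card) :=
        Finset.sum_le_sum_of_subset_of_nonneg (Finset.filter_subset _ _)
          fun _ _ _ => by positivity
      _ = _ := Finset.sum_pow_mul_eq_add_pow x 1 A
  have h2 : ((x + 1) ^ A.card : ℝ) ≤ Real.exp (x * N) := by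
    calc _ ≤ Real.exp x ^ A.card := by gcongr; exact Real.add_one_le_exp x
      _ = Real.exp (x * A.card) := by rw [← Real.exp_nat_mul, mul_comm]
      _ ≤ _ := by gcongr
  have h3 : (0 : ℝ) < x ^ (θ * N) := Real.rpow_pos_of_pos hx0 _
  refine le_of_mul_le_mul_right (h1.trans (h2.trans ?_)) h3
  rw [Real.rpow_def_of_pos two_pos, Real.rpow_def_of_pos hx0, ← Real.exp_add]
  refine Real.exp_le_exp.2 ?_
  have h4 : -(Real.log x * θ) ≤ κ * Real.log 2 / 2 := by
    have : θ * (2 * (1 - Real.log x)) = κ * Real.log 2 := div_mul_cancel₀ _ hden.ne'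
    nlinarith
  nlinarith [mul_le_mul_of_nonneg_right h4 hN, mul_le_mul_of_nonneg_right hx2 hN]

/-! ### Iteration and the final count -/

theorem numSumFree_le_two_pow {G : Type*} [AddCommGroup G] (A : Finset G) :
    numSumFree A ≤ 2 ^ A.card := by
  rw [← Finset.card_powerset]
  exact Finset.card_le_card fun S hS => Finset.mem_powerset.2 (mem_sumFreeSubsets.1 hS).1

theorem numSumFree_le_sum {G : Type*} [AddCommGroup G] {A : Finset G} {𝒞 : Finset (Finset G)}
    (h : ∀ S ⊆ A, IsSumFree (S : Set G) → ∃ B ∈ 𝒞, S ⊆ B) :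
    numSumFree A ≤ ∑ B ∈ 𝒞, numSumFree B := by
  classical
  refine (Finset.card_le_card (t := 𝒞.biUnion sumFreeSubsets) fun S hS => ?_).trans
    Finset.card_biUnion_le
  obtain ⟨hSA, hS⟩ := mem_sumFreeSubsets.1 hS
  obtain ⟨B, hB, hSB⟩ := h S hSA hS
  exact Finset.mem_biUnion.2 ⟨B, hB, mem_sumFreeSubsets.2 ⟨hSB, hS⟩⟩

theorem two_pow_maxSumFree_le {G : Type*} [AddCommGroup G] (R : Finset G) :
    2 ^ maxSumFree R ≤ numSumFree R := by
  have hne : (sumFreeSubsets R).Nonempty :=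
    ⟨∅, mem_sumFreeSubsets.2 ⟨Finset.empty_subset _, by simp [IsSumFree]⟩⟩
  obtain ⟨S, hS, hmax⟩ := Finset.exists_mem_eq_sup _ hne Finset.card
  obtain ⟨hSR, hfree⟩ := mem_sumFreeSubsets.1 hS
  rw [maxSumFree, hmax, ← Finset.card_powerset]
  refine Finset.card_le_card fun T hT => ?_
  rw [Finset.mem_powerset] at hT
  exact mem_sumFreeSubsets.2 ⟨hT.trans hSR, hfree.mono (by exact_mod_cast hT)⟩

/-- Iterating the container step bounds the number of sum-free subsets of `A`. -/
theorem numSumFree_le_of_supersaturated {G : Type} [AddCommGroup G] [DecidableEq G]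
    {R : Finset G} {N δ s L m : ℝ} (hN : 0 < N) (hδ : 0 < δ) (hR : (R.card : ℝ) ≤ N)
    (hsch : ∀ A ⊆ R, L ≤ A.card → δ * N ^ 2 ≤ (schurPairs A).card) {q : ℕ} (hq : 0 < q)
    (hqs : (q : ℝ) ≤ s) (hqN : (q : ℝ) ≤ 3 / 8 * δ * N) (hs : 4 * N ≤ δ * q * s)
    (hm0 : 0 ≤ m) (hm : ∀ A ⊆ R, ((smallSubsets A s).card : ℝ) ≤ 2 ^ m) (k : ℕ) :
    ∀ A ⊆ R, (A.card : ℝ) ≤ L + k * (δ / 8 * N) →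
      (numSumFree A : ℝ) ≤ 2 ^ (L + k * (2 * m)) := by
  have hsmall : ∀ (A : Finset G) (M : ℝ), (A.card : ℝ) ≤ M → (numSumFree A : ℝ) ≤ 2 ^ M := by
    intro A M h
    calc (numSumFree A : ℝ) ≤ (2 : ℝ) ^ A.card := by exact_mod_cast numSumFree_le_two_pow A
      _ = 2 ^ (A.card : ℝ) := (Real.rpow_natCast _ _).symm
      _ ≤ _ := Real.rpow_le_rpow_of_exponent_le one_le_two h
  induction k with
  | zero =>
    intro A _ h
    exact hsmall A _ (by simpa using h)
  | succ k ih =>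
    intro A hAR h
    rcases le_or_gt (A.card : ℝ) L with hL | hL
    · exact hsmall A _ (hL.trans (le_add_of_nonneg_right (by positivity)))
    · have hAN : (A.card : ℝ) ≤ N := le_trans (by exact_mod_cast Finset.card_le_card hAR) hR
      obtain ⟨𝒞, hC, hB, hcov⟩ :=
        exists_containers hN hδ hAN (hsch A hAR hL.le) hq hqs hqN hs
      have hC' : (𝒞.card : ℝ) ≤ 2 ^ (2 * m) := by
        calc (𝒞.card : ℝ) ≤ ((smallSubsets A s).card : ℝ) ^ 2 := by exact_mod_cast hC
          _ ≤ ((2 : ℝ) ^ m) ^ 2 := by gcongr; exact hm A hAR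
          _ = _ := by rw [← Real.rpow_natCast, ← Real.rpow_mul two_pos.le]; push_cast; ring_nf
      calc (numSumFree A : ℝ) ≤ ∑ B ∈ 𝒞, (numSumFree B : ℝ) := by
            exact_mod_cast numSumFree_le_sum hcov
        _ ≤ 𝒞.card • (2 : ℝ) ^ (L + k * (2 * m)) := by
            refine Finset.sum_le_card_nsmul _ _ _ fun B hBC => ih B ((hB B hBC).1.trans hAR) ?_
            have := (hB B hBC).2
            push_cast at h
            linarith
        _ ≤ 2 ^ (2 * m) * 2 ^ (L + k * (2 * m)) := by rw [nsmul_eq_mul]; gcongr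
        _ = _ := by rw [← Real.rpow_add two_pos]; push_cast; ring_nf

theorem eventually_numSumFree_latticeBox_le {d : ℕ} (hd : d ≠ 0) {ε : ℝ} (hε : 0 < ε) :
    ∀ᶠ n : ℕ in atTop, (numSumFree (latticeBox n d) : ℝ) ≤
      2 ^ ((maxSumFree (latticeBox n d) : ℝ) + ε * (n : ℝ) ^ d) := by
  obtain ⟨δ, hδ, hsat⟩ := exists_schurPairs_supersaturation d (half_pos hε)
  -- So `k` rounds, each losing `δ / 8 * N`, exhaust the box.
  obtain ⟨k, hk⟩ := exists_nat_ge (8 / δ)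
  let κ : ℝ := ε / (4 * (k + 1))
  have hκ : 0 < κ := by positivity
  obtain ⟨θ, hθ, hθκ⟩ := exists_card_smallSubsets_le hκ
  -- `q` is independent of `n`, yet large enough that fingerprints have at most `θ * N` elements.
  obtain ⟨q, hq⟩ := exists_nat_gt (4 / (δ * θ))
  have hq0 : (0 : ℝ) < q := lt_trans (by positivity) hq
  have hlim : Tendsto (fun n : ℕ => (n : ℝ) ^ d) atTop atTop :=
    (tendsto_pow_atTop hd).comp tendsto_natCast_atTop_atTop
  filter_upwards [hlim.eventually_gt_atTop 0, hlim.eventually_ge_atTop (q / θ),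
    hlim.eventually_ge_atTop (q / (3 / 8 * δ))] with n hN hn₁ hn₂
  set N : ℝ := (n : ℝ) ^ d with hNdef
  have hcard : ((latticeBox n d).card : ℝ) = N := by rw [card_latticeBox]; push_cast; rfl
  have hδk : 8 ≤ k * δ := (div_le_iff₀ hδ).1 hk
  have hqθ : 4 < q * (δ * θ) := (div_lt_iff₀ (by positivity)).1 hq
  have main := numSumFree_le_of_supersaturated (s := θ * N) (m := κ * N) hN hδ hcard.le (hsat n)
    (by exact_mod_cast hq0) (by rw [mul_comm]; exact (div_le_iff₀ hθ).1 hn₁)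
    (by rw [mul_comm]; exact (div_le_iff₀ (by positivity)).1 hn₂)
    (by nlinarith [mul_le_mul_of_nonneg_right hqθ.le hN.le]) (by positivity)
    (fun A hA => hθκ A N (le_trans (by exact_mod_cast Finset.card_le_card hA) hcard.le)) k
    (latticeBox n d) subset_rfl (by
      have h0 : (0 : ℝ) ≤ maxSumFree (latticeBox n d) := Nat.cast_nonneg _
      rw [hcard]
      have : 0 ≤ ε / 2 * N := by positivity
      nlinarith [mul_le_mul_of_nonneg_right hδk hN.le])
  refine main.trans (Real.rpow_le_rpow_of_exponent_le one_le_two ?_)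
  have hkκ : k * (2 * κ) ≤ ε / 2 := by
    have : κ * (4 * (k + 1)) = ε := div_mul_cancel₀ _ (by positivity)
    nlinarith
  nlinarith [mul_le_mul_of_nonneg_right hkκ hN.le]

theorem numSumFree_eq_one_of_subsingleton {G : Type*} [AddCommGroup G] [Subsingleton G]
    (R : Finset G) : numSumFree R = 1 ∧ maxSumFree R = 0 := by
  have h : sumFreeSubsets R = {∅} := by
    ext S
    rw [mem_sumFreeSubsets, Finset.mem_singleton]
    constructor
    · rintro ⟨-, hS⟩
      refine Finset.eq_empty_of_forall_notMem fun x hx => ?_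
      exact hS x hx x hx x hx (Subsingleton.elim _ _)
    · rintro rfl
      exact ⟨Finset.empty_subset _, by simp [IsSumFree]⟩
  simp [numSumFree, maxSumFree, h]

theorem mainTheorem2 (d : ℕ) :
    ∃ e : ℕ → ℝ,
      (e =o[atTop] fun n : ℕ => (n : ℝ) ^ d) ∧
      ∀ n : ℕ, (numSumFree (latticeBox n d) : ℝ) =
        (2 : ℝ) ^ ((maxSumFree (latticeBox n d) : ℝ) + e n) := by
  rcases eq_or_ne d 0 with rfl | hd
  · refine ⟨0, isLittleO_zero _ _, fun n => ?_⟩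
    obtain ⟨h₁, h₂⟩ := numSumFree_eq_one_of_subsingleton (latticeBox n 0)
    simp [h₁, h₂]
  · have hlow : ∀ n, (2 : ℝ) ^ (maxSumFree (latticeBox n d) : ℝ) ≤ numSumFree (latticeBox n d) := by
      intro n
      rw [Real.rpow_natCast]
      exact_mod_cast two_pow_maxSumFree_le _
    have hpos : ∀ n, (0 : ℝ) < numSumFree (latticeBox n d) := fun n =>
      lt_of_lt_of_le (by positivity) (hlow n)
    refine ⟨fun n => Real.logb 2 (numSumFree (latticeBox n d)) - maxSumFree (latticeBox n d),
      isLittleO_iff.2 fun ε hε => ?_, fun n => ?_⟩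
    · filter_upwards [eventually_numSumFree_latticeBox_le hd hε] with n hn
      have h₁ := (Real.le_logb_iff_rpow_le one_lt_two (hpos n)).2 (hlow n)
      have h₂ := (Real.logb_le_iff_le_rpow one_lt_two (hpos n)).2 hn
      rw [Real.norm_of_nonneg (by linarith), Real.norm_of_nonneg (by positivity)]
      linarith
    · rw [add_sub_cancel, Real.rpow_logb two_pos (by norm_num) (hpos n)]
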